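/- For an odd power $q = 2^{2m+1}$ of $2$ with $m \ge 1$, let $\pi$ be the automorphism $x \mapsto x^{2^{m+1}}$ of $\mathrm{GF}(q)$ and let $\mathrm{Sz}(q)$ be the subgroup of $\mathrm{GL}(4,q)$ generated by all matrices $$S(a,b)=\begin{pmatrix}1&0&0&0\\ a&1&0&0\\ b&a\pi&1&0\\ a^2(a\pi)+ab+b\pi&a(a\pi)+b&a&1\end{pmatrix}\quad (a,b\in \mathrm{GF}(q)),$$ all matrices $M(\lambda)=\mathrm{diag}(\lambda^{1+2^m},\lambda^{2^m},\lambda^{-2^m},\lambda^{-1-2^m})$ with $\lambda\in \mathrm{GF}(q)^\times$, and the antidiagonal permutation matrix $T$. Let $s = 2^{2p+1}$ with $p \ge 1$, let $q = 2^{2m+1} = s^t$ with $t > 1$, and let $G = \mathrm{Sz}(q)$. Let $G_1 \le G$ be a subgroup isomorphic to $\mathrm{Sz}(s)$, and let $S_1$ be a Sylow $2$-subgroup of $G_1$. Write $H^u = u^{-1}Hu$. Then for every $u \in G$ the intersection $S_1 \cap S_1^u$ is one of $1$, $Z(S_1)$, $S_1$. Moreover, each of these three occurs: there are $u_1, u_2,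 u_3 \in G$ with $S_1\cap S_1^{u_1} = 1$, $S_1 \cap S_1^{u_2} = Z(S_1)$ and $S_1\cap S_1^{u_3} = S_1$. -/

import Mathlib

/-- The matrix `S(a,b)`, where `π` is the map `x ↦ x ^ (2 ^ (m + 1))`. If `K` has `2 ^ (2 m + 1)`
elements, `π` is the unique automorphism of `K` whose square is `x ↦ x ^ 2`. -/
def suzukiS {K : Type*} [Field K] (m : ℕ) (a b : K) : Matrix (Fin 4) (Fin 4) K :=
  !![1, 0, 0, 0;
     a, 1, 0, 0;
     b, a ^ (2 ^ (m + 1)), 1, 0;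
     a ^ 2 * a ^ (2 ^ (m + 1)) + a * b + b ^ (2 ^ (m + 1)), a * a ^ (2 ^ (m + 1)) + b, a, 1]

/-- The diagonal matrix `M(l)`, for a unit `l` of `K`. -/
def suzukiM {K : Type*} [Field K] (m : ℕ) (l : Kˣ) : Matrix (Fin 4) (Fin 4) K :=
  Matrix.diagonal ![(l : K) ^ (1 + 2 ^ m), (l : K) ^ (2 ^ m),
    ((l : K) ^ (2 ^ m))⁻¹, ((l : K) ^ (1 + 2 ^ m))⁻¹]

/-- The antidiagonal permutation matrix `T`. -/
def suzukiT (K : Type*) [Field K] : Matrix (Fin 4) (Fin 4) K :=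
  !![0, 0, 0, 1;
     0, 0, 1, 0;
     0, 1, 0, 0;
     1, 0, 0, 0]

theorem suzukiS_det {K : Type*} [Field K] (m : ℕ) (a b : K) : (suzukiS m a b).det ≠ 0 := by
  simp [suzukiS, Matrix.det_succ_row_zero, Fin.sum_univ_succ, Fin.succAbove]

theorem suzukiM_det {K : Type*} [Field K] (m : ℕ) (l : Kˣ) : (suzukiM m l).det ≠ 0 := by
  simp [suzukiM, Matrix.det_diagonal, Fin.prod_univ_succ]

theorem suzukiT_det (K : Type*) [Field K] : (suzukiT K).det ≠ 0 := by
  simp [suzukiT, Matrix.det_succ_row_zero, Fin.sum_univ_succ, Fin.succAbove]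

/-- For a field `K` with `q = 2 ^ (2 m + 1)` elements, this is the Suzuki group `Sz(q)`: the
subgroup of `GL(4,q)` generated by all the matrices `S(a,b)`, `M(l)` and `T`. -/
def suzukiGroup (K : Type*) [Field K] (m : ℕ) : Subgroup (Matrix.GeneralLinearGroup (Fin 4) K) :=
  Subgroup.closure
    (Set.range (fun x : K × K =>
        Matrix.GeneralLinearGroup.mkOfDetNeZero (suzukiS m x.1 x.2) (suzukiS_det m x.1 x.2)) ∪
      Set.range (fun l : Kˣ =>
        Matrix.GeneralLinearGroup.mkOfDetNeZero (suzukiM m l) (suzukiM_det m l)) ∪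
      {Matrix.GeneralLinearGroup.mkOfDetNeZero (suzukiT K) (suzukiT_det K)})

/-- The conjugate `H ^ u = u⁻¹ H u` of a subgroup. -/
def subgroupConj {G : Type*} [Group G] (H : Subgroup G) (u : G) : Subgroup G :=
  H.map (MulAut.conj u⁻¹).toMonoidHom

/-- The center `Z(H)` of a subgroup `H` of `G`, as a subgroup of `G`. -/
def subgroupCenter {G : Type*} [Group G] (H : Subgroup G) : Subgroup G :=
  (Subgroup.center H).map H.subtype

/-! ### The twist `π`, a square root of Frobenius. -/

section Twist

variable {K : Type*} [Field K]

/-! Let `U` be the group of all `S(a,b)`, and `B` the group of all `S(a,b) M(l)`. The Bruhat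
decomposition `G = B ∪ U T B` gives two facts. The index of `B` is `q² + 1`, which is odd, so every
2-subgroup fixes a coset and is conjugate into `U` (`exists_conj_le_unipotent`). And `U ∩ U^u = 1`
for `u ∉ B` (`mem_borel_of_conj_mem`).

Let `F` be the subfield of order `s`. The Sylow subgroup `S₁` is the image of the unipotent group of
`Sz(s)` under an embedding. Up to conjugation this image is the group `U(F)` of all `S(a,b)` with
`a, b ∈ F`: a torus generator of `Sz(s)` can be moved to some `M(n)` with `n` generating `Fˣ`, and
its conjugation action then determines the whole image (`exists_conj_map_unipotent`).

It remains to intersect `U(F)` with `U(F)^u`. For `u ∉ B` the result is trivial. For `u = S(x,y)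
M(l)` it is trivial if `l ∉ F`, everything if `l, x ∈ F`, and the centre if `l ∈ F`, `x ∉ F`. The
last case uses that `[K : F] = t` is odd, so that `z² + z ∈ F` implies `z ∈ F`. -/

theorem charP_two_of_card {m : ℕ} (hK : Nat.card K = 2 ^ (2 * m + 1)) : CharP K 2 := by
  have : Finite K := Nat.finite_of_card_ne_zero (by rw [hK]; positivity)
  have := Fintype.ofFinite K
  have : Fact (Nat.Prime 2) := ⟨Nat.prime_two⟩
  rw [Nat.card_eq_fintype_card] at hK
  exact charP_of_card_eq_prime_pow hK

/-- The map `π : x ↦ x ^ (2 ^ (m + 1))`. -/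
def suzukiTwist (m : ℕ) (x : K) : K := x ^ (2 ^ (m + 1))

theorem suzukiTwist_mul (m : ℕ) (x y : K) :
    suzukiTwist m (x * y) = suzukiTwist m x * suzukiTwist m y := mul_pow _ _ _

theorem suzukiTwist_div (m : ℕ) (x y : K) :
    suzukiTwist m (x / y) = suzukiTwist m x / suzukiTwist m y := div_pow _ _ _

theorem suzukiTwist_pow (m : ℕ) (x : K) (n : ℕ) :
    suzukiTwist m (x ^ n) = suzukiTwist m x ^ n := pow_right_comm _ _ _

@[simp] theorem suzukiTwist_zero (m : ℕ) : suzukiTwist m (0 : K) = 0 := by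
  simp [suzukiTwist]

@[simp] theorem suzukiTwist_one (m : ℕ) : suzukiTwist m (1 : K) = 1 := one_pow _

@[simp] theorem suzukiTwist_eq_zero {m : ℕ} {x : K} : suzukiTwist m x = 0 ↔ x = 0 := by
  simp [suzukiTwist]

theorem suzukiTwist_add [CharP K 2] (m : ℕ) (x y : K) :
    suzukiTwist m (x + y) = suzukiTwist m x + suzukiTwist m y := by
  have : Fact (Nat.Prime 2) := ⟨Nat.prime_two⟩
  exact add_pow_char_pow x y 2 (m + 1)

theorem pow_card_eq {n : ℕ} (hK : Nat.card K = n) (h : n ≠ 0) (x : K) : x ^ n = x := by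
  have : Finite K := Nat.finite_of_card_ne_zero (by rw [hK]; exact h)
  have := Fintype.ofFinite K
  rw [Nat.card_eq_fintype_card] at hK
  rw [← hK]; exact FiniteField.pow_card x

theorem suzukiTwist_twist {m : ℕ} (hK : Nat.card K = 2 ^ (2 * m + 1)) (x : K) :
    suzukiTwist m (suzukiTwist m x) = x ^ 2 := by
  have := pow_card_eq hK (by positivity) x
  unfold suzukiTwist
  rw [← pow_mul, ← pow_add, show m + 1 + (m + 1) = (2 * m + 1) + 1 by ring, pow_succ, pow_mul, this]

/-- Since `π² ` is squaring, `x ↦ x π(x)` and `x ↦ π(x)/x` are mutually inverse on nonzero elements;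
the next lemma is the other composite. -/
theorem suzukiTwist_mul_self_div {m : ℕ} (hK : Nat.card K = 2 ^ (2 * m + 1)) {x : K} (hx : x ≠ 0) :
    suzukiTwist m (x * suzukiTwist m x) / (x * suzukiTwist m x) = x := by
  have h := suzukiTwist_twist hK x
  have h' : suzukiTwist m x ≠ 0 := by simpa using hx
  rw [suzukiTwist_mul, h]; field_simp

theorem suzukiTwist_div_self_mul {m : ℕ} (hK : Nat.card K = 2 ^ (2 * m + 1)) {x : K} (hx : x ≠ 0) :
    (suzukiTwist m x / x) * suzukiTwist m (suzukiTwist m x / x) = x := by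
  have h := suzukiTwist_twist hK x
  have h' : suzukiTwist m x ≠ 0 := by simpa using hx
  rw [suzukiTwist_div, h]; field_simp

theorem eq_zero_or_one_of_suzukiTwist_eq {m : ℕ} (hK : Nat.card K = 2 ^ (2 * m + 1)) {x : K}
    (hx : suzukiTwist m x = x) : x = 0 ∨ x = 1 := by
  have h := suzukiTwist_twist hK x
  rw [hx, hx] at h
  have : x * (x - 1) = 0 := by linear_combination -h
  rcases mul_eq_zero.1 this with h | h
  · exact Or.inl h
  · exact Or.inr (sub_eq_zero.1 h)

end Twist

/-! ### Multiplication rules for the generators. -/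

namespace suzukiGroup

variable {K : Type*} [Field K]

/-- `S(a,b)` as an element of the Suzuki group. -/
def S (m : ℕ) (a b : K) : suzukiGroup K m :=
  ⟨Matrix.GeneralLinearGroup.mkOfDetNeZero (suzukiS m a b) (suzukiS_det m a b),
    Subgroup.subset_closure (Or.inl (Or.inl ⟨(a, b), rfl⟩))⟩

/-- `M(l)` as an element of the Suzuki group. -/
def M (m : ℕ) (l : Kˣ) : suzukiGroup K m :=
  ⟨Matrix.GeneralLinearGroup.mkOfDetNeZero (suzukiM m l) (suzukiM_det m l),
    Subgroup.subset_closure (Or.inl (Or.inr ⟨l, rfl⟩))⟩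

variable (K) in
/-- `T` as an element of the Suzuki group. -/
def T (m : ℕ) : suzukiGroup K m :=
  ⟨Matrix.GeneralLinearGroup.mkOfDetNeZero (suzukiT K) (suzukiT_det K),
    Subgroup.subset_closure (Or.inr rfl)⟩

/-- The underlying matrix of an element of the Suzuki group. -/
def mat {m : ℕ} (g : suzukiGroup K m) : Matrix (Fin 4) (Fin 4) K :=
  ((g : Matrix.GeneralLinearGroup (Fin 4) K) : Matrix (Fin 4) (Fin 4) K)

theorem mat_injective {m : ℕ} : Function.Injective (mat : suzukiGroup K m → _) :=
  fun _ _ h => Subtype.ext (Units.ext h)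

@[simp] theorem mat_mul {m : ℕ} (g h : suzukiGroup K m) : mat (g * h) = mat g * mat h := rfl

@[simp] theorem mat_one {m : ℕ} : mat (1 : suzukiGroup K m) = 1 := rfl

theorem mat_S (m : ℕ) (a b : K) : mat (S m a b) =
  !![1, 0, 0, 0;
     a, 1, 0, 0;
     b, suzukiTwist m a, 1, 0;
     a ^ 2 * suzukiTwist m a + a * b + suzukiTwist m b, a * suzukiTwist m a + b, a, 1] := rfl

theorem mat_T (m : ℕ) : mat (T K m) = !![0, 0, 0, 1; 0, 0, 1, 0; 0, 1, 0, 0; 1, 0, 0, 0] := rfl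

theorem mat_M (m : ℕ) (l : Kˣ) : mat (M m l) =
  !![(l : K) ^ (1 + 2 ^ m), 0, 0, 0; 0, (l : K) ^ (2 ^ m), 0, 0;
    0, 0, ((l : K) ^ (2 ^ m))⁻¹, 0; 0, 0, 0, ((l : K) ^ (1 + 2 ^ m))⁻¹] := by
  change suzukiM m l = _
  ext i j
  fin_cases i <;> fin_cases j <;> simp [suzukiM]

theorem S_zero_zero (m : ℕ) : S m (0 : K) 0 = 1 := by
  apply mat_injective
  rw [mat_S, mat_one]
  ext i j
  fin_cases i <;> fin_cases j <;> simp

theorem S_injective {m : ℕ} {a b c d : K} (h : S m a b = S m c d) : a = c ∧ b = d := by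
  have h := congrArg mat h
  rw [mat_S, mat_S] at h
  exact ⟨by simpa using congrFun (congrFun h 1) 0, by simpa using congrFun (congrFun h 2) 0⟩

theorem S_mul {m : ℕ} (hK : Nat.card K = 2 ^ (2 * m + 1)) (a b c d : K) :
    S m a b * S m c d = S m (a + c) (b + d + suzukiTwist m a * c) := by
  have := charP_two_of_card hK
  have h2 : (2 : K) = 0 := CharTwo.two_eq_zero
  apply mat_injective
  rw [mat_mul, mat_S, mat_S, mat_S]
  simp only [suzukiTwist_add, suzukiTwist_mul, suzukiTwist_twist hK]
  ext i j
  fin_cases i <;> fin_cases j <;> simp [Matrix.mul_apply, Fin.sum_univ_four] <;> grind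

theorem M_mul (m : ℕ) (l n : Kˣ) : M m l * M m n = M m (l * n) := by
  apply mat_injective
  rw [mat_mul, mat_M, mat_M, mat_M]
  ext i j
  fin_cases i <;> fin_cases j <;> simp [Matrix.mul_apply, Fin.sum_univ_four, mul_pow, mul_comm]

theorem M_one (m : ℕ) : M m (1 : Kˣ) = 1 := by
  have := M_mul m (1 : Kˣ) 1
  simpa using this

theorem M_inv (m : ℕ) (l : Kˣ) : (M m l)⁻¹ = M m l⁻¹ :=
  inv_eq_of_mul_eq_one_right (by rw [M_mul, mul_inv_cancel, M_one])

theorem M_pow (m : ℕ) (l : Kˣ) (n : ℕ) : M m l ^ n = M m (l ^ n) := by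
  induction n with
  | zero => simp [M_one]
  | succ n ih => rw [pow_succ, ih, M_mul, pow_succ]

theorem T_mul_T (m : ℕ) : T K m * T K m = 1 := by
  apply mat_injective
  rw [mat_mul, mat_T, mat_one]
  ext i j
  fin_cases i <;> fin_cases j <;> simp [Matrix.mul_apply, Fin.sum_univ_four]

theorem T_inv (m : ℕ) : (T K m)⁻¹ = T K m := inv_eq_of_mul_eq_one_right (T_mul_T m)

theorem T_mul_M (m : ℕ) (l : Kˣ) : T K m * M m l = M m l⁻¹ * T K m := by
  apply mat_injective
  rw [mat_mul, mat_mul, mat_T, mat_M, mat_M]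
  ext i j
  fin_cases i <;> fin_cases j <;> simp [Matrix.mul_apply, Fin.sum_univ_four]

theorem twist_half {m : ℕ} (x : K) : suzukiTwist m x = x ^ (2 ^ m) * x ^ (2 ^ m) := by
  rw [suzukiTwist, pow_succ, pow_mul, sq]

theorem S_mul_M {m : ℕ} (hK : Nat.card K = 2 ^ (2 * m + 1)) (a b : K) (l : Kˣ) :
    S m a b * M m l = M m l * S m ((l : K) * a) ((l : K) * suzukiTwist m (l : K) * b) := by
  have hl : (l : K) ≠ 0 := l.ne_zero
  apply mat_injective
  rw [mat_mul, mat_mul, mat_S, mat_M, mat_S]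
  simp only [suzukiTwist_mul, suzukiTwist_twist hK, pow_add, pow_one]
  rw [twist_half (l : K)]
  have hx : (l : K) ^ (2 ^ m) ≠ 0 := pow_ne_zero _ hl
  generalize (l : K) ^ (2 ^ m) = x at *
  ext i j
  fin_cases i <;> fin_cases j <;> simp [Matrix.mul_apply, Fin.sum_univ_four] <;>
    field_simp

/-- The polynomial whose values are the lower left entries of the matrices `S(a,b)`. -/
def corner (m : ℕ) (a b : K) : K := a ^ 2 * suzukiTwist m a + a * b + suzukiTwist m b

theorem twist_corner {m : ℕ} (hK : Nat.card K = 2 ^ (2 * m + 1)) (a b : K) :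
    suzukiTwist m (corner m a b) =
      suzukiTwist m a ^ 2 * a ^ 2 + suzukiTwist m a * suzukiTwist m b + b ^ 2 := by
  have := charP_two_of_card hK
  simp only [corner, suzukiTwist_add, suzukiTwist_mul, suzukiTwist_pow, suzukiTwist_twist hK]

/-- If the corner `f` vanishes, so does `π(f)`. The two equations combine to `b² π(b) = 0`, and `b =
0` leaves `a² π(a) = 0`. -/
theorem corner_ne_zero {m : ℕ} (hK : Nat.card K = 2 ^ (2 * m + 1)) {a b : K} (h : a ≠ 0 ∨ b ≠ 0) :
    corner m a b ≠ 0 := by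
  have := charP_two_of_card hK
  have h2 : (2 : K) = 0 := CharTwo.two_eq_zero
  intro h0
  have h1 := twist_corner hK a b
  rw [h0, suzukiTwist_zero] at h1
  unfold corner at h0
  have h3 : b ^ 2 * suzukiTwist m b = 0 := by grind
  have hb : b = 0 := by simpa using h3
  subst hb
  simp at h0 h
  exact h h0

/-- The relation that puts `T S(a,b) T` into `U T B`. The value of `l` is the one for which the
first diagonal entry of `M(l)` is the corner. -/
theorem T_mul_S_mul_T {m : ℕ} (hK : Nat.card K = 2 ^ (2 * m + 1)) (a b : K)
    (h : corner m a b ≠ 0) (l : Kˣ) (hl : (l : K) = corner m a b ^ 2 / suzukiTwist m (corner m a b)) :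
    T K m * S m a b * T K m * S m ((b + a * suzukiTwist m a) / corner m a b) (a / corner m a b) =
      S m (b / corner m a b) (a / corner m a b) * M m l * T K m := by
  have := charP_two_of_card hK
  have h2 : (2 : K) = 0 := CharTwo.two_eq_zero
  have hF0 : suzukiTwist m (corner m a b) ≠ 0 := by simpa using h
  have hF := twist_corner hK a b
  have hlr : (l : K) ^ (2 ^ m) = suzukiTwist m (corner m a b) / corner m a b := by
    have := pow_card_eq hK (by positivity) (corner m a b)
    rw [hl, div_pow, suzukiTwist, ← pow_mul, ← pow_mul, ← pow_add,
      show m + 1 + m = 2 * m + 1 by ring, this, ← pow_succ']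
  have hl1 : (l : K) ^ (1 + 2 ^ m) = corner m a b := by
    rw [pow_add, hlr, hl]; field_simp
  apply mat_injective
  simp only [mat_mul]
  rw [mat_S, mat_S, mat_S, mat_M, mat_T, hl1, hlr]
  simp only [suzukiTwist_div, suzukiTwist_add, suzukiTwist_mul, suzukiTwist_twist hK]
  have hf : corner m a b = a ^ 2 * suzukiTwist m a + a * b + suzukiTwist m b := rfl
  generalize suzukiTwist m (corner m a b) = F at *
  generalize corner m a b = f at *
  generalize suzukiTwist m a = A at *
  generalize suzukiTwist m b = B at *
  clear hl1 hlr hl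
  ext i j
  fin_cases i <;> fin_cases j <;> simp [Matrix.mul_apply, Fin.sum_univ_four] <;> 
    field_simp <;> grind

end suzukiGroup

/-! ### Borel subgroup, Bruhat decomposition and 2-subgroups. -/

namespace suzukiGroup

variable {K : Type*} [Field K] {m : ℕ}

theorem S_inv (hK : Nat.card K = 2 ^ (2 * m + 1)) (a b : K) :
    (S m a b)⁻¹ = S m a (b + suzukiTwist m a * a) := by
  have := charP_two_of_card hK
  apply inv_eq_of_mul_eq_one_right
  rw [S_mul hK, ← S_zero_zero]
  congr 1
  · exact CharTwo.add_self_eq_zero a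
  · rw [← add_assoc, CharTwo.add_self_eq_zero b, zero_add, CharTwo.add_self_eq_zero]

theorem S_sq (hK : Nat.card K = 2 ^ (2 * m + 1)) (a b : K) :
    S m a b ^ 2 = S m 0 (suzukiTwist m a * a) := by
  have := charP_two_of_card hK
  rw [sq, S_mul hK, CharTwo.add_self_eq_zero, CharTwo.add_self_eq_zero, zero_add]

theorem S_pow_four (hK : Nat.card K = 2 ^ (2 * m + 1)) (a b : K) : S m a b ^ 4 = 1 := by
  have h : S m a b ^ 4 = (S m a b ^ 2) ^ 2 := by rw [← pow_mul]
  rw [h, S_sq hK, S_sq hK, mul_zero, S_zero_zero]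

theorem S_eq_one {a b : K} : S m a b = 1 ↔ a = 0 ∧ b = 0 := by
  refine ⟨fun h => S_injective (h.trans (S_zero_zero m).symm), ?_⟩
  rintro ⟨rfl, rfl⟩
  exact S_zero_zero m

theorem M_mul_S (hK : Nat.card K = 2 ^ (2 * m + 1)) (a b : K) (l : Kˣ) :
    M m l * S m a b =
      S m (((l⁻¹ : Kˣ) : K) * a)
        (((l⁻¹ : Kˣ) : K) * suzukiTwist m ((l⁻¹ : Kˣ) : K) * b) * M m l := by
  have h := S_mul_M hK a b l⁻¹
  have h1 : M m l * M m l⁻¹ = 1 := by rw [M_mul, mul_inv_cancel, M_one]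
  have h2 : M m l⁻¹ * M m l = 1 := by rw [M_mul, inv_mul_cancel, M_one]
  calc M m l * S m a b = M m l * (S m a b * M m l⁻¹) * M m l := by
        rw [mul_assoc, mul_assoc, h2, mul_one]
    _ = _ := by rw [h, ← mul_assoc, h1, one_mul]

/-- The conjugation action of the torus on the matrices `S(a,b)`. -/
theorem M_conj_S (hK : Nat.card K = 2 ^ (2 * m + 1)) (a b : K) (l : Kˣ) :
    (M m l)⁻¹ * S m a b * M m l = S m ((l : K) * a) ((l : K) * suzukiTwist m (l : K) * b) := by
  rw [mul_assoc, S_mul_M hK, inv_mul_cancel_left]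

theorem S_conj_S (hK : Nat.card K = 2 ^ (2 * m + 1)) (a b x y : K) :
    (S m x y)⁻¹ * S m a b * S m x y =
      S m a (b + suzukiTwist m a * x + suzukiTwist m x * a) := by
  have := charP_two_of_card hK
  rw [mul_assoc, inv_mul_eq_iff_eq_mul, S_mul hK, S_mul hK]
  congr 1
  · exact add_comm _ _
  · have h2 : (2 : K) = 0 := CharTwo.two_eq_zero
    linear_combination (-(suzukiTwist m x * a)) * h2

theorem S_mul_M_mul (hK : Nat.card K = 2 ^ (2 * m + 1)) (a b c d : K) (l n : Kˣ) :
    ∃ x y, S m a b * M m l * (S m c d * M m n) = S m x y * M m (l * n) := by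
  rw [mul_assoc, ← mul_assoc (M m l), M_mul_S hK, mul_assoc, M_mul, ← mul_assoc, S_mul hK]
  exact ⟨_, _, rfl⟩

/-- The subgroup of all the matrices `S(a,b)`. -/
def unipotent (hK : Nat.card K = 2 ^ (2 * m + 1)) : Subgroup (suzukiGroup K m) where
  carrier := {g | ∃ a b, g = S m a b}
  mul_mem' := by
    rintro _ _ ⟨a, b, rfl⟩ ⟨c, d, rfl⟩
    exact ⟨_, _, S_mul hK a b c d⟩
  one_mem' := ⟨0, 0, (S_zero_zero m).symm⟩
  inv_mem' := by
    rintro _ ⟨a, b, rfl⟩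
    exact ⟨_, _, S_inv hK a b⟩

/-- The subgroup of all the products `S(a,b) M(l)`. -/
def borel (hK : Nat.card K = 2 ^ (2 * m + 1)) : Subgroup (suzukiGroup K m) where
  carrier := {g | ∃ a b l, g = S m a b * M m l}
  mul_mem' := by
    rintro _ _ ⟨a, b, l, rfl⟩ ⟨c, d, n, rfl⟩
    obtain ⟨x, y, h⟩ := S_mul_M_mul hK a b c d l n
    exact ⟨x, y, _, h⟩
  one_mem' := ⟨0, 0, 1, by rw [S_zero_zero, M_one, one_mul]⟩
  inv_mem' := by
    rintro _ ⟨a, b, l, rfl⟩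
    rw [mul_inv_rev, M_inv, S_inv hK, M_mul_S hK]
    exact ⟨_, _, _, rfl⟩

theorem S_mem_unipotent (hK : Nat.card K = 2 ^ (2 * m + 1)) (a b : K) :
    S m a b ∈ unipotent hK := ⟨a, b, rfl⟩

theorem unipotent_le_borel (hK : Nat.card K = 2 ^ (2 * m + 1)) : unipotent hK ≤ borel hK := by
  rintro _ ⟨a, b, rfl⟩
  exact ⟨a, b, 1, by rw [M_one, mul_one]⟩

theorem S_mem_borel (hK : Nat.card K = 2 ^ (2 * m + 1)) (a b : K) : S m a b ∈ borel hK :=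
  unipotent_le_borel hK (S_mem_unipotent hK a b)

theorem M_mem_borel (hK : Nat.card K = 2 ^ (2 * m + 1)) (l : Kˣ) : M m l ∈ borel hK :=
  ⟨0, 0, l, by rw [S_zero_zero, one_mul]⟩

theorem isPGroup_unipotent (hK : Nat.card K = 2 ^ (2 * m + 1)) : IsPGroup 2 (unipotent hK) := by
  rintro ⟨_, a, b, rfl⟩
  exact ⟨2, Subtype.ext (S_pow_four hK a b)⟩

theorem conj_mem_unipotent (hK : Nat.card K = 2 ^ (2 * m + 1)) {g h : suzukiGroup K m}
    (hg : g ∈ unipotent hK) (hh : h ∈ borel hK) : h⁻¹ * g * h ∈ unipotent hK := by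
  obtain ⟨a, b, rfl⟩ := hg
  obtain ⟨x, y, l, rfl⟩ := hh
  have : (S m x y * M m l)⁻¹ * S m a b * (S m x y * M m l) =
    (M m l)⁻¹ * ((S m x y)⁻¹ * S m a b * S m x y) * M m l := by group
  rw [this, S_conj_S hK, M_conj_S hK]
  exact S_mem_unipotent hK _ _

theorem S_mul_M_pow (hK : Nat.card K = 2 ^ (2 * m + 1)) (a b : K) (l : Kˣ) (n : ℕ) :
    ∃ x y, (S m a b * M m l) ^ n = S m x y * M m (l ^ n) := by
  induction n with
  | zero => exact ⟨0, 0, by rw [S_zero_zero, pow_zero, pow_zero, M_one, one_mul]⟩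
  | succ n ih =>
    obtain ⟨x, y, h⟩ := ih
    rw [pow_succ, h, pow_succ]
    exact S_mul_M_mul hK _ _ _ _ _ _

theorem mat_borel_upper (hK : Nat.card K = 2 ^ (2 * m + 1)) {g : suzukiGroup K m}
    (hg : g ∈ borel hK) : mat g 0 1 = 0 ∧ mat g 0 2 = 0 ∧ mat g 0 3 = 0 := by
  obtain ⟨a, b, l, rfl⟩ := hg
  rw [mat_mul, mat_S, mat_M]
  simp [Matrix.mul_apply, Fin.sum_univ_four]

theorem S_mul_M_injective {a b : K} {l : Kˣ} (h : S m a b * M m l = 1) :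
    S m a b = 1 ∧ l = 1 := by
  have h' := congrArg mat h
  rw [mat_mul, mat_S, mat_M, mat_one] at h'
  have h0 : (l : K) ^ (1 + 2 ^ m) = 1 := by
    simpa [Matrix.mul_apply, Fin.sum_univ_four] using congrFun (congrFun h' 0) 0
  have h1 : (l : K) ^ (2 ^ m) = 1 := by
    simpa [Matrix.mul_apply, Fin.sum_univ_four] using congrFun (congrFun h' 1) 1
  have hl : l = 1 := by
    rw [pow_add, h1, pow_one, mul_one] at h0
    exact Units.ext h0
  refine ⟨?_, hl⟩
  rwa [hl, M_one, mul_one] at h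

theorem T_mul_S_mul_T_notMem (hK : Nat.card K = 2 ^ (2 * m + 1)) {a b : K}
    (h : T K m * S m a b * T K m ∈ borel hK) : a = 0 ∧ b = 0 := by
  obtain ⟨h1, h2, -⟩ := mat_borel_upper hK h
  rw [mat_mul, mat_mul, mat_T, mat_S] at h1 h2
  have h1 : a = 0 := by simpa [Matrix.mul_apply, Fin.sum_univ_four] using h1
  subst h1
  exact ⟨rfl, by simpa [Matrix.mul_apply, Fin.sum_univ_four] using h2⟩

theorem S_mul_T_notMem (hK : Nat.card K = 2 ^ (2 * m + 1)) (a b : K) :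
    S m a b * T K m ∉ borel hK := by
  intro h
  have h3 := (mat_borel_upper hK h).2.2
  rw [mat_mul, mat_T, mat_S] at h3
  simp [Matrix.mul_apply, Fin.sum_univ_four] at h3

theorem T_notMem (hK : Nat.card K = 2 ^ (2 * m + 1)) : T K m ∉ borel hK := by
  have := S_mul_T_notMem hK (0 : K) 0
  rwa [S_zero_zero, one_mul] at this

theorem T_mul_S_mul_T_eq (hK : Nat.card K = 2 ^ (2 * m + 1)) {a b : K} (h : a ≠ 0 ∨ b ≠ 0) :
    ∃ c d, ∃ g ∈ borel hK, T K m * S m a b * T K m = S m c d * T K m * g := by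
  have h0 := corner_ne_zero hK h
  have h1 : corner m a b ^ 2 / suzukiTwist m (corner m a b) ≠ 0 := by simpa using h0
  have := T_mul_S_mul_T hK a b h0 (Units.mk0 _ h1) rfl
  rw [mul_assoc (S m _ _) (M m _), ← inv_inv (Units.mk0 _ h1), ← T_mul_M, ← eq_mul_inv_iff_mul_eq,
    ← mul_assoc, mul_assoc _ (M m _)] at this
  exact ⟨_, _, _, mul_mem (M_mem_borel hK _) (inv_mem (S_mem_borel hK _ _)), this⟩

/-- The union `B ∪ U T B` is stable under left multiplication by the generators. Only `T` acting on
`S(c,d) T B` needs an argument: `T_mul_S_mul_T_eq` if `S(c,d) ≠ 1`, and `T² = 1` otherwise. -/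
theorem bruhat (hK : Nat.card K = 2 ^ (2 * m + 1)) (g : suzukiGroup K m) :
    g ∈ borel hK ∨ ∃ c d, ∃ h ∈ borel hK, g = S m c d * T K m * h := by
  set X : suzukiGroup K m → Prop := fun g =>
    g ∈ borel hK ∨ ∃ c d, ∃ h ∈ borel hK, g = S m c d * T K m * h with hX
  have hS : ∀ a b g, X g → X (S m a b * g) := by
    rintro a b g (hg | ⟨c, d, h, hh, rfl⟩)
    · exact Or.inl (mul_mem (S_mem_borel hK _ _) hg)
    · exact Or.inr ⟨_, _, h, hh, by rw [← mul_assoc, ← mul_assoc, S_mul hK]⟩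
  have hM : ∀ l g, X g → X (M m l * g) := by
    rintro l g (hg | ⟨c, d, h, hh, rfl⟩)
    · exact Or.inl (mul_mem (M_mem_borel hK _) hg)
    · have e : M m l * T K m = T K m * M m l⁻¹ := by rw [T_mul_M, inv_inv]
      rw [← mul_assoc, ← mul_assoc, M_mul_S hK, mul_assoc _ (M m l), e, ← mul_assoc, mul_assoc _ _ h]
      exact Or.inr ⟨_, _, _, mul_mem (M_mem_borel hK _) hh, rfl⟩
  have hT : ∀ g, X g → X (T K m * g) := by
    rintro g (hg | ⟨c, d, h, hh, rfl⟩)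
    · exact Or.inr ⟨0, 0, g, hg, by rw [S_zero_zero, one_mul]⟩
    · by_cases hcd : c ≠ 0 ∨ d ≠ 0
      · obtain ⟨c', d', h', hh', e⟩ := T_mul_S_mul_T_eq hK hcd
        refine Or.inr ⟨c', d', h' * h, mul_mem hh' hh, ?_⟩
        rw [← mul_assoc, ← mul_assoc, e, mul_assoc]
      · push Not at hcd
        rw [hcd.1, hcd.2, S_zero_zero, one_mul, ← mul_assoc, T_mul_T, one_mul]
        exact Or.inl hh
  obtain ⟨g, hg⟩ := g
  change X ⟨g, hg⟩
  induction hg using Subgroup.closure_induction_left with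
  | one => exact Or.inl (one_mem _)
  | mul_left x hx y hy ih =>
    rcases hx with (⟨⟨a, b⟩, rfl⟩ | ⟨l, rfl⟩) | rfl
    · exact hS a b _ ih
    · exact hM l _ ih
    · exact hT _ ih
  | inv_mul_cancel x hx y hy ih =>
    rcases hx with (⟨⟨a, b⟩, rfl⟩ | ⟨l, rfl⟩) | rfl
    · change X ((S m a b)⁻¹ * ⟨y, hy⟩)
      rw [S_inv hK]
      exact hS _ _ _ ih
    · change X ((M m l)⁻¹ * ⟨y, hy⟩)
      rw [M_inv]
      exact hM _ _ ih
    · change X ((T K m)⁻¹ * ⟨y, hy⟩)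
      rw [T_inv]
      exact hT _ ih

/-- The cosets are `B` and the `S(c,d) T B`. The latter are distinct because `T S(a,b) T ∈ B` forces
`S(a,b) = 1`. -/
theorem card_quotient_borel (hK : Nat.card K = 2 ^ (2 * m + 1)) :
    Nat.card (suzukiGroup K m ⧸ borel hK) = Nat.card K ^ 2 + 1 := by
  have : Finite K := Nat.finite_of_card_ne_zero (by rw [hK]; positivity)
  let f : Option (K × K) → suzukiGroup K m ⧸ borel hK := fun o =>
    o.elim ((1 : suzukiGroup K m) : suzukiGroup K m ⧸ borel hK)
      (fun x => ((S m x.1 x.2 * T K m : suzukiGroup K m) : suzukiGroup K m ⧸ borel hK))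
  have hf : Function.Bijective f := by
    constructor
    · rintro (_ | ⟨a, b⟩) (_ | ⟨c, d⟩) h
      · rfl
      · have h := QuotientGroup.eq.1 h
        rw [inv_one, one_mul] at h
        exact absurd h (S_mul_T_notMem hK c d)
      · have h := QuotientGroup.eq.1 h.symm
        rw [inv_one, one_mul] at h
        exact absurd h (S_mul_T_notMem hK a b)
      · have h := QuotientGroup.eq.1 h
        rw [mul_inv_rev, T_inv, mul_assoc, ← mul_assoc (S m _ _)⁻¹] at h
        obtain ⟨x, y, hxy⟩ : (S m a b)⁻¹ * S m c d ∈ unipotent hK :=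
          mul_mem (inv_mem (S_mem_unipotent hK _ _)) (S_mem_unipotent hK _ _)
        dsimp only at h
        rw [hxy, ← mul_assoc] at h
        obtain ⟨rfl, rfl⟩ := T_mul_S_mul_T_notMem hK h
        rw [S_zero_zero, inv_mul_eq_one] at hxy
        obtain ⟨rfl, rfl⟩ := S_injective hxy
        rfl
    · intro x
      induction x using QuotientGroup.induction_on with
      | H g =>
        rcases bruhat hK g with hg | ⟨c, d, h, hh, rfl⟩
        · exact ⟨none, QuotientGroup.eq.2 (by rwa [inv_one, one_mul])⟩
        · exact ⟨some (c, d), QuotientGroup.eq.2 (by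
            change (S m c d * T K m)⁻¹ * (S m c d * T K m * h) ∈ borel hK
            rwa [inv_mul_cancel_left])⟩
  rw [← Nat.card_congr (Equiv.ofBijective f hf), Finite.card_option, Nat.card_prod, sq]

/-- The torus part `l` satisfies `l ^ 2 ^ n = 1`, and Frobenius is injective, so `l = 1`. -/
theorem mem_unipotent_of_pow (hK : Nat.card K = 2 ^ (2 * m + 1)) {g : suzukiGroup K m}
    (hg : g ∈ borel hK) {n : ℕ} (hn : g ^ 2 ^ n = 1) : g ∈ unipotent hK := by
  have := charP_two_of_card hK
  have : Fact (Nat.Prime 2) := ⟨Nat.prime_two⟩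
  obtain ⟨a, b, l, rfl⟩ := hg
  obtain ⟨x, y, h⟩ := S_mul_M_pow hK a b l (2 ^ n)
  rw [h] at hn
  have hl := (S_mul_M_injective hn).2
  have hl' : (l : K) ^ 2 ^ n = 1 := by
    rw [← Units.val_pow_eq_pow_val, hl, Units.val_one]
  have : l = 1 := by
    apply Units.ext
    apply iterateFrobenius_inj K 2 n
    simpa [iterateFrobenius_def] using hl'
  rw [this, M_one, mul_one]
  exact S_mem_unipotent hK a b

/-- Every `2`-subgroup is conjugate to a subgroup of the unipotent subgroup. -/
theorem exists_conj_le_unipotent (hK : Nat.card K = 2 ^ (2 * m + 1))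
    {Q : Subgroup (suzukiGroup K m)} (hQ : IsPGroup 2 Q) :
    ∃ g : suzukiGroup K m, ∀ x ∈ Q, g⁻¹ * x * g ∈ unipotent hK := by
  have : Fact (Nat.Prime 2) := ⟨Nat.prime_two⟩
  have hc := card_quotient_borel hK
  have : Finite (suzukiGroup K m ⧸ borel hK) :=
    Nat.finite_of_card_ne_zero (by rw [hc]; positivity)
  have h := hQ.card_modEq_card_fixedPoints (suzukiGroup K m ⧸ borel hK)
  rw [hc, hK] at h
  -- The number of fixed cosets is congruent to the odd number `q² + 1` modulo 2.
  have hne : Nat.card (MulAction.fixedPoints Q (suzukiGroup K m ⧸ borel hK)) ≠ 0 := by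
    intro h0
    rw [h0] at h
    have h2 : 2 ∣ (2 ^ (2 * m + 1)) ^ 2 + 1 := (Nat.modEq_zero_iff_dvd).1 h
    have h3 : 2 ∣ (2 ^ (2 * m + 1)) ^ 2 := dvd_pow (dvd_pow_self 2 (by omega)) two_ne_zero
    have := (Nat.dvd_add_right h3).1 h2
    omega
  obtain ⟨⟨x, hx⟩⟩ := (Nat.card_ne_zero.1 hne).1
  obtain ⟨g, rfl⟩ := QuotientGroup.mk_surjective x
  refine ⟨g, fun y hy => ?_⟩
  have h1 := (MulAction.mem_fixedPoints.1 hx) ⟨y, hy⟩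
  have h2 : g⁻¹ * (y * g) ∈ borel hK := QuotientGroup.eq.1 h1.symm
  rw [← mul_assoc] at h2
  obtain ⟨n, hn⟩ := hQ ⟨y, hy⟩
  have hn : y ^ 2 ^ n = 1 := congrArg Subtype.val hn
  refine mem_unipotent_of_pow hK h2 (n := n) ?_
  have := conj_pow (i := 2 ^ n) (a := g⁻¹) (b := y)
  rw [inv_inv] at this
  rw [this, hn, mul_one, inv_mul_cancel]

/-- Distinct conjugates of the unipotent subgroup intersect trivially. -/
theorem mem_borel_of_conj_mem (hK : Nat.card K = 2 ^ (2 * m + 1)) {g x : suzukiGroup K m}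
    (hx : x ∈ unipotent hK) (hx1 : x ≠ 1) (h : g⁻¹ * x * g ∈ borel hK) : g ∈ borel hK := by
  rcases bruhat hK g with hg | ⟨c, d, b, hb, rfl⟩
  · exact hg
  exfalso
  -- Conjugating `b` away leaves `T S' T ∈ B`, with `S'` the conjugate of `x` by `S(c,d)`; this
  -- forces `S' = 1`, hence `x = 1`.
  have h1 : T K m * ((S m c d)⁻¹ * x * S m c d) * T K m ∈ borel hK := by
    have := mul_mem (mul_mem hb h) (inv_mem hb)
    convert this using 1
    nth_rewrite 1 [← T_inv]
    group
  obtain ⟨a', b', e⟩ := conj_mem_unipotent hK hx (S_mem_borel hK c d)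
  rw [e] at h1
  obtain ⟨rfl, rfl⟩ := T_mul_S_mul_T_notMem hK h1
  rw [S_zero_zero] at e
  apply hx1
  have : x = S m c d * ((S m c d)⁻¹ * x * S m c d) * (S m c d)⁻¹ := by group
  rw [this, e]
  group

end suzukiGroup

/-! ### Conjugation, centres and invariance of the trichotomy. -/

section Conjugation

variable {G : Type*} [Group G]

theorem mem_subgroupConj {H : Subgroup G} {u x : G} :
    x ∈ subgroupConj H u ↔ u * x * u⁻¹ ∈ H := by
  constructor
  · rintro ⟨y, hy, rfl⟩
    simpa [mul_assoc] using hy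
  · intro h
    exact ⟨_, h, by simp [mul_assoc]⟩

theorem subgroupConj_subgroupConj (H : Subgroup G) (u v : G) :
    subgroupConj (subgroupConj H u) v = subgroupConj H (u * v) := by
  ext x
  simp only [mem_subgroupConj, mul_inv_rev, mul_assoc]

theorem subgroupConj_inf (H L : Subgroup G) (u : G) :
    subgroupConj (H ⊓ L) u = subgroupConj H u ⊓ subgroupConj L u := by
  ext x
  simp only [mem_subgroupConj, Subgroup.mem_inf]

theorem subgroupConj_bot (u : G) : subgroupConj (⊥ : Subgroup G) u = ⊥ :=
  Subgroup.map_bot _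

theorem subgroupConj_one (H : Subgroup G) : subgroupConj H 1 = H := by
  ext x
  simp [mem_subgroupConj]

theorem mem_subgroupCenter {H : Subgroup G} {x : G} :
    x ∈ subgroupCenter H ↔ x ∈ H ∧ ∀ y ∈ H, y * x = x * y := by
  constructor
  · rintro ⟨⟨y, hy⟩, hc, rfl⟩
    exact ⟨hy, fun z hz => congrArg Subtype.val (Subgroup.mem_center_iff.1 hc ⟨z, hz⟩)⟩
  · rintro ⟨hx, hc⟩
    exact ⟨⟨x, hx⟩, Subgroup.mem_center_iff.2 fun ⟨z, hz⟩ => Subtype.ext (hc z hz), rfl⟩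

theorem subgroupCenter_subgroupConj (H : Subgroup G) (u : G) :
    subgroupCenter (subgroupConj H u) = subgroupConj (subgroupCenter H) u := by
  ext x
  simp only [mem_subgroupCenter, mem_subgroupConj]
  refine and_congr_right fun _ => ⟨fun h y hy => ?_, fun h y hy => ?_⟩
  · have := h (u⁻¹ * y * u) (by simpa [mul_assoc] using hy)
    have := congrArg (fun z => u * z * u⁻¹) this
    simpa [mul_assoc] using this
  · have := h (u * y * u⁻¹) hy
    have := congrArg (fun z => u⁻¹ * z * u) this
    simpa [mul_assoc] using this

/-- The intersections of `H` with its conjugates are exactly `1`, `Z(H)` and `H`. -/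
def ConjInfTrichotomy (H : Subgroup G) : Prop :=
  (∀ u, H ⊓ subgroupConj H u = ⊥ ∨ H ⊓ subgroupConj H u = subgroupCenter H ∨
      H ⊓ subgroupConj H u = H) ∧
    (∃ u, H ⊓ subgroupConj H u = ⊥) ∧ (∃ u, H ⊓ subgroupConj H u = subgroupCenter H) ∧
    (∃ u, H ⊓ subgroupConj H u = H)

/-- Conjugation by `g` carries `H ∩ H^(g u g⁻¹)` to `H^g ∩ (H^g)^u`, and `u ↦ g u g⁻¹` is a
bijection. -/
theorem ConjInfTrichotomy.subgroupConj {H : Subgroup G} (h : ConjInfTrichotomy H) (g : G) :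
    ConjInfTrichotomy (subgroupConj H g) := by
  have key : ∀ u, _root_.subgroupConj H g ⊓ _root_.subgroupConj (_root_.subgroupConj H g) u =
      _root_.subgroupConj (H ⊓ _root_.subgroupConj H (g * u * g⁻¹)) g := by
    intro u
    rw [subgroupConj_inf, subgroupConj_subgroupConj, subgroupConj_subgroupConj,
      inv_mul_cancel_right]
  have key' : ∀ v, g * (g⁻¹ * v * g) * g⁻¹ = v := fun v => by group
  obtain ⟨h0, ⟨u1, h1⟩, ⟨u2, h2⟩, ⟨u3, h3⟩⟩ := h
  refine ⟨fun u => ?_, ⟨g⁻¹ * u1 * g, ?_⟩, ⟨g⁻¹ * u2 * g, ?_⟩, ⟨g⁻¹ * u3 * g, ?_⟩⟩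
  · rw [key]
    rcases h0 (g * u * g⁻¹) with e | e | e
    · exact Or.inl (by rw [e, subgroupConj_bot])
    · exact Or.inr (Or.inl (by rw [e, subgroupCenter_subgroupConj]))
    · exact Or.inr (Or.inr (by rw [e]))
  · rw [key, key', h1, subgroupConj_bot]
  · rw [key, key', h2, subgroupCenter_subgroupConj]
  · rw [key, key', h3]

end Conjugation

/-! ### Intersections of conjugates of the unipotent group over a subfield. -/

namespace suzukiGroup

variable {K : Type*} [Field K] {m : ℕ}

theorem twist_mem {F : Subfield K} {x : K} (hx : x ∈ F) : suzukiTwist m x ∈ F := pow_mem hx _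

theorem mem_of_mul_twist_mem (hK : Nat.card K = 2 ^ (2 * m + 1)) {F : Subfield K} {x : K}
    (hx0 : x ≠ 0) (hx : x * suzukiTwist m x ∈ F) : x ∈ F := by
  have := div_mem (twist_mem (m := m) hx) hx
  rwa [suzukiTwist_mul_self_div hK hx0] at this

/-- The subgroup of the matrices `S(a,b)` with `a` and `b` in a subfield. -/
def subfieldUnipotent (hK : Nat.card K = 2 ^ (2 * m + 1)) (F : Subfield K) :
    Subgroup (suzukiGroup K m) where
  carrier := {g | ∃ a ∈ F, ∃ b ∈ F, g = S m a b}
  mul_mem' := by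
    rintro _ _ ⟨a, ha, b, hb, rfl⟩ ⟨c, hc, d, hd, rfl⟩
    exact ⟨_, add_mem ha hc, _, add_mem (add_mem hb hd) (mul_mem (twist_mem ha) hc),
      S_mul hK a b c d⟩
  one_mem' := ⟨0, zero_mem F, 0, zero_mem F, (S_zero_zero m).symm⟩
  inv_mem' := by
    rintro _ ⟨a, ha, b, hb, rfl⟩
    exact ⟨_, ha, _, add_mem hb (mul_mem (twist_mem ha) ha), S_inv hK a b⟩

theorem mem_subfieldUnipotent {hK : Nat.card K = 2 ^ (2 * m + 1)} {F : Subfield K}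
    {g : suzukiGroup K m} :
    g ∈ subfieldUnipotent hK F ↔ ∃ a ∈ F, ∃ b ∈ F, g = S m a b := Iff.rfl

theorem S_mem_subfieldUnipotent {hK : Nat.card K = 2 ^ (2 * m + 1)} {F : Subfield K} {a b : K} :
    S m a b ∈ subfieldUnipotent hK F ↔ a ∈ F ∧ b ∈ F := by
  constructor
  · rintro ⟨c, hc, d, hd, e⟩
    obtain ⟨rfl, rfl⟩ := S_injective e
    exact ⟨hc, hd⟩
  · rintro ⟨ha, hb⟩
    exact ⟨a, ha, b, hb, rfl⟩

theorem subfieldUnipotent_le (hK : Nat.card K = 2 ^ (2 * m + 1)) (F : Subfield K) :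
    subfieldUnipotent hK F ≤ unipotent hK := by
  rintro _ ⟨a, _, b, _, rfl⟩
  exact ⟨a, b, rfl⟩

theorem subfieldUnipotent_inf_eq_bot (hK : Nat.card K = 2 ^ (2 * m + 1)) (F : Subfield K)
    {u : suzukiGroup K m} (hu : u ∉ borel hK) :
    subfieldUnipotent hK F ⊓ subgroupConj (subfieldUnipotent hK F) u = ⊥ := by
  rw [eq_bot_iff]
  rintro x ⟨hx, hx'⟩
  have hx' := mem_subgroupConj.1 hx'
  by_contra h1
  have h1 : x ≠ 1 := h1
  apply hu
  have := mem_borel_of_conj_mem hK (g := u⁻¹) (subfieldUnipotent_le hK F hx) h1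
    (by rw [inv_inv]; exact unipotent_le_borel hK (subfieldUnipotent_le hK F hx'))
  simpa using inv_mem this

theorem mem_subgroupCenter_subfieldUnipotent (hK : Nat.card K = 2 ^ (2 * m + 1)) {F : Subfield K}
    (hF : ∃ x ∈ F, x ≠ 0 ∧ x ≠ 1) {g : suzukiGroup K m} :
    g ∈ subgroupCenter (subfieldUnipotent hK F) ↔ ∃ b ∈ F, g = S m 0 b := by
  rw [mem_subgroupCenter]
  constructor
  · rintro ⟨⟨a, ha, b, hb, rfl⟩, hc⟩
    by_cases h0 : a = 0
    · exact ⟨b, hb, by rw [h0]⟩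
    obtain ⟨x, hx, hx0, hx1⟩ := hF
    -- Commuting with `S(xa,0)` forces `π(x) = x`, which fails for `x` outside `{0, 1}`.
    have h := hc (S m (x * a) 0) (S_mem_subfieldUnipotent.2 ⟨mul_mem hx ha, zero_mem F⟩)
    rw [S_mul hK, S_mul hK] at h
    have h := (S_injective h).2
    rw [suzukiTwist_mul] at h
    have h' : suzukiTwist m a * a ≠ 0 := mul_ne_zero (by simpa using h0) h0
    have : suzukiTwist m x = x := mul_right_cancel₀ h' (by linear_combination h)
    rcases eq_zero_or_one_of_suzukiTwist_eq hK this with h | h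
    · exact absurd h hx0
    · exact absurd h hx1
  · rintro ⟨b, hb, rfl⟩
    refine ⟨S_mem_subfieldUnipotent.2 ⟨zero_mem F, hb⟩, ?_⟩
    rintro _ ⟨c, hc, d, hd, rfl⟩
    rw [S_mul hK, S_mul hK]
    congr 1
    · exact add_comm _ _
    · simp [add_comm]

theorem S_mul_M_conj (hK : Nat.card K = 2 ^ (2 * m + 1)) (x y : K) (l : Kˣ) (a b : K) :
    (S m x y * M m l)⁻¹ * S m a b * (S m x y * M m l) = S m ((l : K) * a)
      ((l : K) * suzukiTwist m (l : K) * (b + suzukiTwist m a * x + suzukiTwist m x * a)) := by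
  rw [← M_conj_S hK, ← S_conj_S hK _ _ _ y]
  group

theorem S_mem_conj (hK : Nat.card K = 2 ^ (2 * m + 1)) (F : Subfield K) (x y : K) (l : Kˣ)
    (c d : K) :
    S m c d ∈ subgroupConj (subfieldUnipotent hK F) (S m x y * M m l) ↔
      ∃ a ∈ F, ∃ b ∈ F, c = (l : K) * a ∧
        d = (l : K) * suzukiTwist m (l : K) * (b + suzukiTwist m a * x + suzukiTwist m x * a) := by
  rw [mem_subgroupConj, mem_subfieldUnipotent]
  refine exists_congr fun a => and_congr_right fun _ => exists_congr fun b =>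
    and_congr_right fun _ => ?_
  constructor
  · intro h
    apply S_injective
    rw [← S_mul_M_conj hK x y, ← h]
    group
  · rintro ⟨rfl, rfl⟩
    rw [← S_mul_M_conj hK x y]
    group

theorem subfieldUnipotent_inf_eq_self (hK : Nat.card K = 2 ^ (2 * m + 1)) {F : Subfield K}
    {x y : K} {l : Kˣ} (hx : x ∈ F) (hl : (l : K) ∈ F) :
    subfieldUnipotent hK F ⊓ subgroupConj (subfieldUnipotent hK F) (S m x y * M m l) =
      subfieldUnipotent hK F := by
  have := charP_two_of_card hK
  have h2 : (2 : K) = 0 := CharTwo.two_eq_zero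
  rw [inf_eq_left]
  rintro _ ⟨c, hc, d, hd, rfl⟩
  have hl0 : (l : K) ≠ 0 := l.ne_zero
  have hl1 : suzukiTwist m (l : K) ≠ 0 := by simp
  have ha : c / (l : K) ∈ F := div_mem hc hl
  refine (S_mem_conj hK F x y l c d).2 ⟨c / (l : K), ha,
    d / (l * suzukiTwist m (l : K)) +
      (suzukiTwist m (c / (l : K)) * x + suzukiTwist m x * (c / (l : K))), ?_, ?_, ?_⟩
  · exact add_mem (div_mem hd (mul_mem hl (twist_mem hl)))
      (add_mem (mul_mem (twist_mem ha) hx) (mul_mem (twist_mem hx) ha))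
  · field_simp
  · generalize suzukiTwist m (c / (l : K)) = A
    field_simp
    linear_combination (-(suzukiTwist m (l : K) * (A * x * l + suzukiTwist m x * c))) * h2

/-- If `S(la, d)` with `a ≠ 0` were in the intersection, then `z = x/a` would satisfy `z + π(z) ∈
F`. Adding the image under `π` gives `z² + z ∈ F`, so `z ∈ F` and `x ∈ F`. -/
theorem subfieldUnipotent_inf_eq_center (hK : Nat.card K = 2 ^ (2 * m + 1)) {F : Subfield K}
    (hF : ∃ x ∈ F, x ≠ 0 ∧ x ≠ 1) (hF' : ∀ z : K, z ^ 2 + z ∈ F → z ∈ F)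
    {x y : K} {l : Kˣ} (hx : x ∉ F) (hl : (l : K) ∈ F) :
    subfieldUnipotent hK F ⊓ subgroupConj (subfieldUnipotent hK F) (S m x y * M m l) =
      subgroupCenter (subfieldUnipotent hK F) := by
  have := charP_two_of_card hK
  have h2 : (2 : K) = 0 := CharTwo.two_eq_zero
  have hl0 : (l : K) ≠ 0 := l.ne_zero
  have hl1 : suzukiTwist m (l : K) ≠ 0 := by simp
  ext g
  rw [mem_subgroupCenter_subfieldUnipotent hK hF, Subgroup.mem_inf]
  constructor
  · rintro ⟨⟨c, hc, d, hd, rfl⟩, h⟩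
    obtain ⟨a, ha, b, hb, rfl, rfl⟩ := (S_mem_conj hK F x y l _ _).1 h
    refine ⟨_, hd, ?_⟩
    suffices a = 0 by rw [this, mul_zero]
    by_contra ha0
    have ha1 : suzukiTwist m a ≠ 0 := by simpa using ha0
    apply hx
    have h3 := div_mem hd (mul_mem hl (twist_mem (m := m) hl))
    rw [mul_div_cancel_left₀ _ (mul_ne_zero hl0 hl1)] at h3
    have h4 : x / a + suzukiTwist m (x / a) ∈ F := by
      have := div_mem (sub_mem h3 hb) (mul_mem ha (twist_mem (m := m) ha))
      convert this using 1
      rw [suzukiTwist_div]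
      field_simp
      ring
    have h5 : (x / a) ^ 2 + x / a ∈ F := by
      have := add_mem (twist_mem (m := m) h4) h4
      rw [suzukiTwist_add, suzukiTwist_twist hK] at this
      convert this using 1
      linear_combination (-suzukiTwist m (x / a)) * h2
    have := mul_mem (hF' _ h5) ha
    rwa [div_mul_cancel₀ _ ha0] at this
  · rintro ⟨d, hd, rfl⟩
    refine ⟨S_mem_subfieldUnipotent.2 ⟨zero_mem F, hd⟩, (S_mem_conj hK F x y l _ _).2
      ⟨0, zero_mem F, d / ((l : K) * suzukiTwist m (l : K)),
        div_mem hd (mul_mem hl (twist_mem hl)), by rw [mul_zero], ?_⟩⟩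
    rw [suzukiTwist_zero]
    field_simp
    ring

theorem conjInfTrichotomy_subfieldUnipotent (hK : Nat.card K = 2 ^ (2 * m + 1)) {F : Subfield K}
    (hF : ∃ x ∈ F, x ≠ 0 ∧ x ≠ 1) (hF' : ∀ z : K, z ^ 2 + z ∈ F → z ∈ F) (hF'' : ∃ x, x ∉ F) :
    ConjInfTrichotomy (subfieldUnipotent hK F) := by
  refine ⟨fun u => ?_, ⟨T K m, subfieldUnipotent_inf_eq_bot hK F (T_notMem hK)⟩, ?_,
    ⟨1, by rw [subgroupConj_one, inf_idem]⟩⟩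
  · by_cases hu : u ∈ borel hK
    · obtain ⟨x, y, l, rfl⟩ := hu
      by_cases hl : (l : K) ∈ F
      · by_cases hx : x ∈ F
        · exact Or.inr (Or.inr (subfieldUnipotent_inf_eq_self hK hx hl))
        · exact Or.inr (Or.inl (subfieldUnipotent_inf_eq_center hK hF hF' hx hl))
      -- For `l ∉ F`, `la ∈ F` forces `a = 0`; then `l π(l) b ∈ F` forces `b = 0`, because `l` is
      -- recovered from `l π(l)` inside `F`.
      · refine Or.inl (eq_bot_iff.2 ?_)
        rintro _ ⟨⟨c, hc, d, hd, rfl⟩, h⟩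
        obtain ⟨a, ha, b, hb, rfl, rfl⟩ := (S_mem_conj hK F x y l _ _).1 h
        have ha0 : a = 0 := by
          by_contra ha0
          apply hl
          have := div_mem hc ha
          rwa [mul_div_cancel_right₀ _ ha0] at this
        subst ha0
        have hb0 : b = 0 := by
          by_contra hb0
          apply hl
          apply mem_of_mul_twist_mem hK l.ne_zero
          rw [suzukiTwist_zero, zero_mul, mul_zero, add_zero, add_zero] at hd
          have := div_mem hd hb
          rwa [mul_div_cancel_right₀ _ hb0] at this
        subst hb0
        exact S_eq_one.2 ⟨by simp, by simp⟩
    · exact Or.inl (subfieldUnipotent_inf_eq_bot hK F hu)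
  · obtain ⟨x, hx⟩ := hF''
    refine ⟨S m x 0 * M m 1, subfieldUnipotent_inf_eq_center hK hF hF' hx ?_⟩
    rw [Units.val_one]
    exact one_mem F

end suzukiGroup

/-! ### Fixed fields of Frobenius powers. -/

section FixedField

variable {K : Type*} [Field K]

/-- The subfield of the solutions of `x ^ (2 ^ n) = x` in a field of characteristic two. -/
def frobeniusFixedField (K : Type*) [Field K] [CharP K 2] (n : ℕ) : Subfield K :=
  RingHom.eqLocusField (iterateFrobenius K 2 n) (RingHom.id K)

theorem mem_frobeniusFixedField [CharP K 2] {n : ℕ} {x : K} :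
    x ∈ frobeniusFixedField K n ↔ x ^ 2 ^ n = x := Iff.rfl

theorem exists_notMem_frobeniusFixedField [Finite K] [CharP K 2] {n : ℕ} (hn : n ≠ 0)
    (h : 2 ^ n < Nat.card K) : ∃ x, x ∉ frobeniusFixedField K n := by
  by_contra! hx
  have : Fintype K := Fintype.ofFinite K
  have h1 : 1 < 2 ^ n := Nat.one_lt_two_pow hn
  have hne := FiniteField.X_pow_card_sub_X_ne_zero K h1
  have hsub : Finset.univ.val ⊆ (Polynomial.X ^ 2 ^ n - Polynomial.X : Polynomial K).roots := by
    intro x _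
    rw [Polynomial.mem_roots hne]
    simp [mem_frobeniusFixedField.1 (hx x)]
  have hle := Polynomial.card_le_degree_of_subset_roots hsub
  rw [FiniteField.X_pow_card_sub_X_natDegree_eq K h1] at hle
  rw [Nat.card_eq_fintype_card] at h
  exact absurd hle (not_le.2 h)

/-- A Frobenius fixed field over which `K` has odd degree is closed under solutions of quadratic
equations `z ^ 2 + z = c`. -/
theorem mem_frobeniusFixedField_of_sq_add [CharP K 2] {n t : ℕ} (ht : Odd t)
    (hK : ∀ x : K, x ^ (2 ^ n) ^ t = x) {z : K} (hz : z ^ 2 + z ∈ frobeniusFixedField K n) :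
    z ∈ frobeniusFixedField K n := by
  have : Fact (Nat.Prime 2) := ⟨Nat.prime_two⟩
  rw [mem_frobeniusFixedField] at hz ⊢
  have h2 : (2 : K) = 0 := CharTwo.two_eq_zero
  rw [add_pow_char_pow, pow_right_comm] at hz
  -- Write `σ` for the `2 ^ n`-power map. As `σ` fixes `z² + z`, the element `w = σ(z) + z`
  -- satisfies `w² + w = 0`.
  have h : (z ^ 2 ^ n + z) * (z ^ 2 ^ n + z + 1) = 0 := by
    linear_combination hz + (z ^ 2 ^ n * z + z ^ 2 + z) * h2
  rcases mul_eq_zero.1 h with h | h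
  · exact CharTwo.add_eq_zero.1 h
  · exfalso
    have h' : z ^ 2 ^ n = z + 1 := by linear_combination h - (z + 1) * h2
    -- If `σ(z) = z + 1`, then `σ^i(z) = z + i`; for `i = t` odd this contradicts `σ^t = id`.
    have hi : ∀ i : ℕ, z ^ (2 ^ n) ^ i = z + i := by
      intro i
      induction i with
      | zero => simp
      | succ i ih =>
        rw [pow_succ, pow_mul, ih, add_pow_char_pow, h']
        have : (i : K) ^ 2 ^ n = i := by
          rcases Nat.even_or_odd i with hi | hi
          · rw [(CharP.cast_eq_zero_iff K 2 i).2 hi.two_dvd, zero_pow (by positivity)]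
          · have : (i : K) = 1 := by
              obtain ⟨j, rfl⟩ := hi
              push_cast
              linear_combination (j : K) * h2
            rw [this, one_pow]
        rw [this]
        push_cast
        ring
    have := hi t
    rw [hK] at this
    obtain ⟨j, rfl⟩ := ht
    push_cast at this
    exact one_ne_zero (α := K) (by linear_combination -this - (j : K) * h2)

end FixedField

/-! ### Embeddings of `Sz(k)` into `Sz(K)`. -/

namespace suzukiGroup

variable {k K : Type*} [Field k] [Field K] {p m : ℕ}

/-- Homomorphism followed by `x ↦ g⁻¹ * x * g`. -/
def conjHom {G H : Type*} [Group G] [Group H] (φ : H →* G) (g : G) : H →* G :=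
  (MulAut.conj g⁻¹).toMonoidHom.comp φ

theorem conjHom_apply {G H : Type*} [Group G] [Group H] (φ : H →* G) (g : G) (x : H) :
    conjHom φ g x = g⁻¹ * φ x * g := by
  simp [conjHom]

theorem conjHom_injective {G H : Type*} [Group G] [Group H] {φ : H →* G}
    (hφ : Function.Injective φ) (g : G) : Function.Injective (conjHom φ g) :=
  (MulAut.conj g⁻¹).injective.comp hφ

/-- Composes the successive normalizing conjugations into a single one. -/
theorem conj_mul_mem_iff {G H : Type*} [Group G] [Group H] {φ : H →* G} {L : Subgroup H}
    {Q : Subgroup G} {g g' : G}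
    (h : ∀ y, y ∈ L.map (conjHom φ g) ↔ g'⁻¹ * y * g' ∈ Q) (y : G) :
    y ∈ L.map φ ↔ (g * g')⁻¹ * y * (g * g') ∈ Q := by
  have e : (g * g')⁻¹ * y * (g * g') = g'⁻¹ * (g⁻¹ * y * g) * g' := by group
  rw [e, ← h]
  constructor
  · rintro ⟨x, hx, rfl⟩
    exact ⟨x, hx, conjHom_apply φ g x⟩
  · rintro ⟨x, hx, h⟩
    rw [conjHom_apply] at h
    exact ⟨x, hx, by simpa using h⟩

theorem twist_mul_self_eq_one (hK : Nat.card K = 2 ^ (2 * m + 1)) {x : K}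
    (h : x * suzukiTwist m x = 1) : x = 1 := by
  have hx : x ≠ 0 := left_ne_zero_of_mul_eq_one h
  rw [← suzukiTwist_mul_self_div hK hx, h, suzukiTwist_one, div_one]

/-- A nontrivial coset representative `S(x,y) M(l)` is conjugate to `M(l)`. -/
theorem exists_conj_eq_M (hK : Nat.card K = 2 ^ (2 * m + 1)) (x y : K) {l : Kˣ} (hl : l ≠ 1) :
    ∃ c d, (S m c d)⁻¹ * (S m x y * M m l) * S m c d = M m l := by
  set n : K := ((l⁻¹ : Kˣ) : K) with hn
  have h1 : 1 - n ≠ 0 := by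
    rw [sub_ne_zero]
    intro h
    exact hl (inv_eq_one.1 (Units.ext h.symm))
  have h2 : 1 - n * suzukiTwist m n ≠ 0 := by
    rw [sub_ne_zero]
    intro h
    exact hl (inv_eq_one.1 (Units.ext (twist_mul_self_eq_one hK h.symm)))
  -- The witnesses solve `c = x + n c` and `d = y + n π(n) d + π(x) n c`.
  refine ⟨x / (1 - n),
    (y + suzukiTwist m x * (n * (x / (1 - n)))) / (1 - n * suzukiTwist m n), ?_⟩
  rw [mul_assoc, inv_mul_eq_iff_eq_mul, mul_assoc, M_mul_S hK, ← mul_assoc, S_mul hK]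
  congr 2
  · field_simp
    ring
  · rw [← hn]
    generalize suzukiTwist m x * (n * (x / (1 - n))) = e
    field_simp
    ring

section Embedding

variable {φ : suzukiGroup k p →* suzukiGroup K m}

/-- Conjugation by the image of `M(l)` keeps the nontrivial element `φ(S(1,0))` inside `U`, which
only elements of `B` can do. -/
theorem map_M_mem_borel (hK : Nat.card K = 2 ^ (2 * m + 1)) (hk : Nat.card k = 2 ^ (2 * p + 1))
    (hφ : Function.Injective φ) (hu : ∀ a b, φ (S p a b) ∈ unipotent hK) (l : kˣ) :
    φ (M p l) ∈ borel hK := by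
  apply mem_borel_of_conj_mem hK (hu 1 0)
  · rw [← map_one φ]
    intro h
    exact one_ne_zero (S_eq_one.1 (hφ h)).1
  · rw [← map_inv, ← map_mul, ← map_mul, M_conj_S hk]
    exact unipotent_le_borel hK (hu _ _)

/-- The normalized case of the description of the unipotent subgroups of subgroups `Sz(k)`. -/
theorem map_unipotent_eq [CharP K 2]
    (hK : Nat.card K = 2 ^ (2 * m + 1)) (hk : Nat.card k = 2 ^ (2 * p + 1))
    {l : kˣ} (hl : ∀ x : kˣ, ∃ i : ℕ, l ^ i = x) {n : Kˣ} (hn1 : n ≠ 1)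
    (hn : (n : K) ∈ frobeniusFixedField K (2 * p + 1))
    (hnF : ∀ x ∈ frobeniusFixedField K (2 * p + 1), x ≠ 0 → ∃ i : ℕ, (n : K) ^ i = x)
    (hM : φ (M p l) = M m n) {γ : K} (hS : φ (S p 1 0) = S m 1 γ) :
    (unipotent hk).map φ = subfieldUnipotent hK (frobeniusFixedField K (2 * p + 1)) := by
  have := charP_two_of_card hk
  have h2 : (2 : K) = 0 := CharTwo.two_eq_zero
  set F := frobeniusFixedField K (2 * p + 1)
  have hMi : ∀ i : ℕ, φ (M p (l ^ i)) = M m (n ^ i) := fun i => by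
    rw [← M_pow, map_pow, hM, M_pow]
  have hconj : ∀ (i : ℕ) (a b : k) (x y : K), φ (S p a b) = S m x y →
      φ (S p ((l : k) ^ i * a) ((l : k) ^ i * suzukiTwist p ((l : k) ^ i) * b)) =
        S m ((n : K) ^ i * x) ((n : K) ^ i * suzukiTwist m ((n : K) ^ i) * y) := by
    intro i a b x y h
    have := congrArg φ (M_conj_S hk a b (l ^ i))
    rw [map_mul, map_mul, map_inv, hMi, h, M_conj_S hK] at this
    simpa using this.symm
  -- The torus is transitive on the nonzero first coordinates, so the image of `S(1,0)` determines
  -- that of every `S(a,0)`.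
  have ha : ∀ i : ℕ, φ (S p ((l : k) ^ i) 0) =
      S m ((n : K) ^ i) ((n : K) ^ i * suzukiTwist m ((n : K) ^ i) * γ) := by
    intro i
    simpa using hconj i 1 0 1 γ hS
  have hS' : φ (S p 0 1) = S m 0 1 := by
    have := congrArg φ (S_sq hk 1 0)
    rw [map_pow, hS, S_sq hK] at this
    simpa using this.symm
  have hb : ∀ i : ℕ, φ (S p 0 ((l : k) ^ i * suzukiTwist p ((l : k) ^ i))) =
      S m 0 ((n : K) ^ i * suzukiTwist m ((n : K) ^ i)) := by
    intro i
    simpa using hconj i 0 1 0 1 hS'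
  have hlk : ∀ x : k, x ≠ 0 → ∃ i : ℕ, (l : k) ^ i = x := by
    intro x hx
    obtain ⟨i, hi⟩ := hl (Units.mk0 x hx)
    exact ⟨i, by rw [← Units.val_pow_eq_pow_val, hi, Units.val_mk0]⟩
  have h00 : φ (S p 0 0) = S m 0 0 := by rw [S_zero_zero, S_zero_zero, map_one]
  have ha1 : ∀ a, ∃ x ∈ F, φ (S p a 0) = S m x (x * suzukiTwist m x * γ) := by
    intro a
    by_cases h : a = 0
    · exact ⟨0, zero_mem F, by rw [h, h00]; simp⟩
    · obtain ⟨i, rfl⟩ := hlk a h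
      exact ⟨_, pow_mem hn i, ha i⟩
  have ha2 : ∀ x ∈ F, ∃ a, φ (S p a 0) = S m x (x * suzukiTwist m x * γ) := by
    intro x hx
    by_cases h : x = 0
    · exact ⟨0, by rw [h, h00]; simp⟩
    · obtain ⟨i, rfl⟩ := hnF x hx h
      exact ⟨_, ha i⟩
  have hb1 : ∀ b, ∃ y ∈ F, φ (S p 0 b) = S m 0 y := by
    intro b
    by_cases h : b = 0
    · exact ⟨0, zero_mem F, by rw [h, h00]⟩
    -- Every nonzero `b` is `c π(c)` with `c = π(b)/b`, so `S(0,b)` is a torus conjugate of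
    -- `S(0,1)`.
    · obtain ⟨i, hi⟩ := hlk (suzukiTwist p b / b) (div_ne_zero (by simpa using h) h)
      have := hb i
      rw [hi, suzukiTwist_div_self_mul hk h] at this
      exact ⟨_, mul_mem (pow_mem hn i) (twist_mem (pow_mem hn i)), this⟩
  have hb2 : ∀ y ∈ F, ∃ b, φ (S p 0 b) = S m 0 y := by
    intro y hy
    by_cases h : y = 0
    · exact ⟨0, by rw [h, h00]⟩
    · obtain ⟨i, hi⟩ := hnF (suzukiTwist m y / y) (div_mem (twist_mem hy) hy)
        (div_ne_zero (by simpa using h) h)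
      have := hb i
      rw [hi, suzukiTwist_div_self_mul hK h] at this
      exact ⟨_, this⟩
  have hsplit : ∀ a b : k, S p a b = S p a 0 * S p 0 b := by
    intro a b
    rw [S_mul hk]
    simp
  have hsplit' : ∀ x y z : K, S m x y * S m 0 z = S m x (y + z) := by
    intro x y z
    rw [S_mul hK]
    simp
  -- Applying `φ` to `S(1,0) S(l,0) = S(1 + l, l)` and comparing second coordinates gives `γ (n +
  -- π(n)) = y + n`, with `y ∈ F`.
  have hγ : γ ∈ F := by
    obtain ⟨x, hx, hx'⟩ := ha1 (1 + l)
    obtain ⟨y, hy, hy'⟩ := hb1 l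
    have h1 := ha 1
    rw [pow_one, pow_one] at h1
    have e := congrArg φ (S_mul hk 1 0 (l : k) 0)
    rw [suzukiTwist_one, add_zero, zero_add, one_mul, hsplit (1 + (l : k)),
      map_mul, map_mul, hS, h1, hx', hy',
      hsplit', S_mul hK] at e
    obtain ⟨rfl, e⟩ := S_injective e
    rw [suzukiTwist_add, suzukiTwist_one] at e
    have hne : (n : K) + suzukiTwist m (n : K) ≠ 0 := by
      intro h
      rcases eq_zero_or_one_of_suzukiTwist_eq hK (CharTwo.add_eq_zero.1 h).symm with h | h
      · exact n.ne_zero h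
      · exact hn1 (Units.ext h)
    have : γ = (y + n) / ((n : K) + suzukiTwist m (n : K)) := by
      rw [eq_div_iff hne]
      linear_combination -e - y * h2
    rw [this]
    exact div_mem (add_mem hy hn) (add_mem hn (twist_mem hn))
  ext g
  constructor
  · rintro ⟨_, ⟨a, b, rfl⟩, rfl⟩
    obtain ⟨x, hx, hx'⟩ := ha1 a
    obtain ⟨y, hy, hy'⟩ := hb1 b
    rw [hsplit, map_mul, hx', hy', hsplit']
    exact S_mem_subfieldUnipotent.2 ⟨hx, add_mem (mul_mem (mul_mem hx (twist_mem hx)) hγ) hy⟩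
  · rintro ⟨x, hx, y, hy, rfl⟩
    obtain ⟨a, ha⟩ := ha2 x hx
    obtain ⟨b, hb⟩ := hb2 (y - x * suzukiTwist m x * γ)
      (sub_mem hy (mul_mem (mul_mem hx (twist_mem hx)) hγ))
    refine ⟨S p a b, ⟨a, b, rfl⟩, ?_⟩
    rw [hsplit, map_mul, ha, hb, hsplit', add_sub_cancel]

/-- If `φ` embeds `Sz(k)` in `Sz(K)`, the image of the unipotent subgroup is conjugate to the
subgroup of the `S(a,b)` with `a` and `b` in the subfield of `K` isomorphic to `k`. -/
theorem exists_conj_map_unipotent [CharP K 2] (hp : 0 < p)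
    (hK : Nat.card K = 2 ^ (2 * m + 1)) (hk : Nat.card k = 2 ^ (2 * p + 1))
    (hφ : Function.Injective φ) :
    (∃ x ∈ frobeniusFixedField K (2 * p + 1), x ≠ 0 ∧ x ≠ 1) ∧
    ∃ g, ∀ y, y ∈ (unipotent hk).map φ ↔
      g⁻¹ * y * g ∈ subfieldUnipotent hK (frobeniusFixedField K (2 * p + 1)) := by
  have : Finite k := Nat.finite_of_card_ne_zero (by rw [hk]; positivity)
  have hs : 2 < 2 ^ (2 * p + 1) := by
    calc 2 < 2 ^ 3 := by norm_num
      _ ≤ _ := Nat.pow_le_pow_right (by norm_num) (by omega)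
  have hcu : Nat.card kˣ = 2 ^ (2 * p + 1) - 1 := by rw [Nat.card_units, hk]
  obtain ⟨l, hl⟩ := IsCyclic.exists_generator (α := kˣ)
  have hlo := orderOf_eq_card_of_forall_mem_zpowers hl
  rw [hcu] at hlo
  have hl : ∀ x : kˣ, ∃ i : ℕ, l ^ i = x := fun x => mem_powers_iff_mem_zpowers.2 (hl x)
  -- conjugate the image of the unipotent subgroup into the unipotent subgroup
  obtain ⟨g₁, hg₁⟩ := exists_conj_le_unipotent hK ((isPGroup_unipotent hk).map φ)
  set φ₁ := conjHom φ g₁ with hφ₁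
  have hi₁ : Function.Injective φ₁ := conjHom_injective hφ g₁
  have hu₁ : ∀ a b, φ₁ (S p a b) ∈ unipotent hK := fun a b => by
    rw [hφ₁, conjHom_apply]
    exact hg₁ _ ⟨_, S_mem_unipotent hk a b, rfl⟩
  obtain ⟨x, y, n, hn⟩ := map_M_mem_borel hK hk hi₁ hu₁ l
  have hno : IsPrimitiveRoot (n : K) (2 ^ (2 * p + 1) - 1) := by
    rw [IsPrimitiveRoot.coe_units_iff, ← hlo]
    -- If `n ^ i = 1`, the image of `M(l ^ i)` lies in `U`, which has exponent dividing 4. So `l ^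
    -- (4i) = 1`, and the order of `l` is odd.
    have key : ∀ i : ℕ, n ^ i = 1 ↔ l ^ i = 1 := by
      intro i
      obtain ⟨x', y', h⟩ := S_mul_M_pow hK x y n i
      rw [← hn] at h
      constructor
      · intro h1
        rw [h1, M_one, mul_one] at h
        have h4 := S_pow_four hK x' y'
        rw [← h, ← map_pow, ← map_pow, ← map_one φ₁] at h4
        have h4 := hi₁ h4
        rw [M_pow, M_pow] at h4
        have h5 : S p 0 0 * M p ((l ^ i) ^ 4) = 1 := by rw [h4, mul_one, S_zero_zero]
        have h6 := (S_mul_M_injective h5).2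
        rw [← pow_mul] at h6
        have h7 := orderOf_dvd_of_pow_eq_one h6
        have hco : Nat.Coprime (orderOf l) 4 := by
          rw [hlo, show 4 = 2 ^ 2 from rfl]
          apply Nat.Coprime.pow_right
          rw [Nat.coprime_two_right, Nat.odd_sub (by omega)]
          simp [Nat.even_pow]
        exact orderOf_dvd_iff_pow_eq_one.1 (hco.dvd_of_dvd_mul_right h7)
      · intro h1
        rw [← map_pow, M_pow, h1, M_one, map_one] at h
        exact (S_mul_M_injective h.symm).2
    have : orderOf n = orderOf l := orderOf_eq_orderOf_iff.2 key
    rw [← this]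
    exact IsPrimitiveRoot.orderOf n
  have hn1 : n ≠ 1 := by
    rintro rfl
    have := hno.dvd_of_pow_eq_one 1 (by simp)
    have := Nat.le_of_dvd one_pos this
    omega
  have hnF : (n : K) ∈ frobeniusFixedField K (2 * p + 1) := by
    rw [mem_frobeniusFixedField, ← Nat.sub_add_cancel (by omega : 1 ≤ 2 ^ (2 * p + 1)), pow_succ,
      hno.pow_eq_one, one_mul]
  -- Nonzero elements of the fixed field are `(s - 1)`-th roots of unity, hence powers of the
  -- primitive root `n`.
  have hnF' : ∀ x ∈ frobeniusFixedField K (2 * p + 1), x ≠ 0 → ∃ i : ℕ, (n : K) ^ i = x := by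
    intro x hx hx0
    have : NeZero (2 ^ (2 * p + 1) - 1) := ⟨by omega⟩
    rw [mem_frobeniusFixedField, ← Nat.sub_add_cancel (by omega : 1 ≤ 2 ^ (2 * p + 1)),
      pow_succ] at hx
    obtain ⟨i, -, hi⟩ := hno.eq_pow_of_pow_eq_one (mul_right_cancel₀ hx0 (hx.trans (one_mul x).symm))
    exact ⟨i, hi⟩
  refine ⟨⟨n, hnF, n.ne_zero, fun h => hn1 (Units.ext h)⟩, ?_⟩
  -- conjugate the image of the torus into the torus
  obtain ⟨c, d, hcd⟩ := exists_conj_eq_M hK x y hn1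
  set φ₂ := conjHom φ₁ (S m c d) with hφ₂
  have hi₂ : Function.Injective φ₂ := conjHom_injective hi₁ _
  have hM₂ : φ₂ (M p l) = M m n := by rw [hφ₂, conjHom_apply, hn, hcd]
  obtain ⟨a, b, hab⟩ : φ₂ (S p 1 0) ∈ unipotent hK := by
    rw [hφ₂, conjHom_apply]
    exact conj_mem_unipotent hK (hu₁ _ _) (S_mem_borel hK c d)
  -- Otherwise the image of `S(1,0)` would square to 1, while `S(1,0)² = S(0,1) ≠ 1`.
  have ha : a ≠ 0 := by
    rintro rfl
    have h := congrArg φ₂ (S_sq hk 1 0)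
    rw [map_pow, hab, S_sq hK, mul_zero, S_zero_zero, ← map_one φ₂] at h
    have := (S_eq_one.1 (hi₂ h).symm).2
    simp at this
  -- conjugate by the torus
  set φ₃ := conjHom φ₂ (M m (Units.mk0 a ha)⁻¹) with hφ₃
  have hM₃ : φ₃ (M p l) = M m n := by
    rw [hφ₃, conjHom_apply, hM₂, M_inv, M_mul, M_mul]
    congr 1
    rw [inv_inv, mul_comm, inv_mul_cancel_left]
  obtain ⟨γ, hS₃⟩ : ∃ γ, φ₃ (S p 1 0) = S m 1 γ := by
    rw [hφ₃, conjHom_apply, hab, M_conj_S hK, Units.val_inv_eq_inv_val, Units.val_mk0,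
      inv_mul_cancel₀ ha]
    exact ⟨_, rfl⟩
  have h₃ := map_unipotent_eq hK hk hl hn1 hnF hnF' hM₃ hS₃
  have h₃' : ∀ y, y ∈ (unipotent hk).map φ₃ ↔
      (1 : suzukiGroup K m)⁻¹ * y * 1 ∈
        subfieldUnipotent hK (frobeniusFixedField K (2 * p + 1)) := fun y => by
    rw [h₃, inv_one, one_mul, mul_one]
  exact ⟨_, conj_mul_mem_iff (conj_mul_mem_iff (conj_mul_mem_iff h₃'))⟩

end Embedding

/-- A Sylow `2`-subgroup of a subgroup isomorphic to `Sz(k)` is the image of the unipotent subgroup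
of `Sz(k)` under an embedding. -/
theorem exists_embedding_of_sylow {G : Type*} [Group G] (hk : Nat.card k = 2 ^ (2 * p + 1))
    {G₁ : Subgroup G} (e : G₁ ≃* suzukiGroup k p) (P : Sylow 2 G₁) :
    ∃ φ : suzukiGroup k p →* G, Function.Injective φ ∧
      (P : Subgroup G₁).map G₁.subtype = (unipotent hk).map φ := by
  obtain ⟨h, hh⟩ := exists_conj_le_unipotent hk (P.isPGroup'.map e.toMonoidHom)
  let ψ : suzukiGroup k p ≃* G₁ := (MulAut.conj h).trans e.symm
  have hle : (P : Subgroup G₁) ≤ (unipotent hk).map ψ.toMonoidHom := by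
    intro x hx
    refine ⟨_, hh (e x) ⟨x, hx, rfl⟩, ?_⟩
    simp [ψ, mul_assoc]
  -- The Sylow subgroup lies in a conjugate of the unipotent group, which is itself a 2-group, so
  -- maximality gives equality.
  have hP := P.is_maximal' ((isPGroup_unipotent hk).map ψ.toMonoidHom) hle
  refine ⟨G₁.subtype.comp ψ.toMonoidHom, G₁.subtype_injective.comp ψ.injective, ?_⟩
  rw [← Subgroup.map_map, hP]

end suzukiGroup

theorem proposition4p8 {k K : Type*} [Field k] [Field K] (p m t : ℕ) (hp : 0 < p) (ht : 1 < t)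
    (hk : Nat.card k = 2 ^ (2 * p + 1)) (hK : Nat.card K = 2 ^ (2 * m + 1))
    (hkK : Nat.card k ^ t = Nat.card K)
    (G₁ : Subgroup (suzukiGroup K m)) (hG₁ : Nonempty (G₁ ≃* suzukiGroup k p))
    (S₁ : Subgroup (suzukiGroup K m))
    (hS₁ : ∃ P : Sylow 2 G₁, S₁ = (P : Subgroup G₁).map G₁.subtype) :
    (∀ u : suzukiGroup K m,
      S₁ ⊓ subgroupConj S₁ u = ⊥ ∨
      S₁ ⊓ subgroupConj S₁ u = subgroupCenter S₁ ∨
      S₁ ⊓ subgroupConj S₁ u = S₁) ∧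
    (∃ u : suzukiGroup K m, S₁ ⊓ subgroupConj S₁ u = ⊥) ∧
    (∃ u : suzukiGroup K m, S₁ ⊓ subgroupConj S₁ u = subgroupCenter S₁) ∧
    (∃ u : suzukiGroup K m, S₁ ⊓ subgroupConj S₁ u = S₁) := by
  have := charP_two_of_card hK
  have : Finite K := Nat.finite_of_card_ne_zero (by rw [hK]; positivity)
  obtain ⟨e⟩ := hG₁
  obtain ⟨P, rfl⟩ := hS₁
  obtain ⟨φ, hφ, hP⟩ := suzukiGroup.exists_embedding_of_sylow hk e P
  obtain ⟨hF, g, hg⟩ := suzukiGroup.exists_conj_map_unipotent hp hK hk hφ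
  have heq : (P : Subgroup G₁).map G₁.subtype = subgroupConj
      (suzukiGroup.subfieldUnipotent hK (frobeniusFixedField K (2 * p + 1))) g⁻¹ := by
    ext y
    rw [hP, hg, mem_subgroupConj, inv_inv]
  rw [heq]
  -- Comparing exponents gives `(2p + 1) t = 2m + 1`.
  have htodd : Odd t := by
    rw [hk, hK, ← pow_mul] at hkK
    have h := Nat.pow_right_injective le_rfl hkK
    have : Odd ((2 * p + 1) * t) := h ▸ odd_two_mul_add_one m
    exact (Nat.odd_mul.1 this).2
  refine (suzukiGroup.conjInfTrichotomy_subfieldUnipotent hK hF (fun z => ?_) ?_).subgroupConj g⁻¹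
  · refine mem_frobeniusFixedField_of_sq_add htodd (fun x => ?_)
    rw [← hk, hkK]
    exact pow_card_eq rfl Nat.card_pos.ne' x
  · apply exists_notMem_frobeniusFixedField (by omega)
    rw [← hkK, hk]
    exact lt_self_pow₀ (Nat.one_lt_two_pow (by omega)) ht
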